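/- All graphs are finite, simple (undirected, without loops or multiple edges) and have at least one vertex. For a graph $G$ let $\alpha(G)$ be its independence number. For graphs $G$ and $H$ let $G\boxtimes H$ be their strong product: its vertex set is $V(G)\times V(H)$, and $(u,u')$, $(v,v')$ are adjacent if and only if $u=v$ and $u'v'\in E(H)$, or $uv\in E(G)$ and $u'=v'$, or $uv\in E(G)$ and $u'v'\in E(H)$. The relative fractional independence number of $G$ with respect to $H$ is $$\alpha^*(G|H)=\sup_{W}\frac{\alpha(G\boxtimes W)}{\alpha(H\boxtimes W)},$$ where the supremum is over all graphs $W$. The fractional independence number $\alpha^*(G)$ is the maximum of $\sum_{v\in V(G)}w_v$ over all weights $w_v\ge 0$ such that $\sum_{v\in S}w_v\le 1$ for every clique $S\subseteq V(G)$. The Lovász number is $$\vartheta(G)=\max\Big\{\sum_{i,j\in V(G)}B_{ij} : B\in\mathbb{R}^{V(G)\times V(G)}\text{ symmetric positive semidefinite},\ \operatorname{tr}B=1,\ B_{ij}=0\text{ for all } ij\in E(G)\Big\}.$$ Schrijver's variant $\vartheta^-(G)$ is the same maximum with the additional constraint that $B_{ij}\ge 0$ for all $i,j$; Szegedy's variant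 $\vartheta^+(G)$ is the same maximum as for $\vartheta(G)$ with the constraint $B_{ij}=0$ for $ij\in E(G)$ relaxed to $B_{ij}\le 0$ for $ij\in E(G)$. **Theorem.** For all graphs $G$ and $H$, $$\alpha^*(G|H)\ \ge\ \frac{X(G)}{X(H)}\ \ge\ \frac{1}{\alpha^*(H|G)},$$ where $X$ is any one of the following five invariants: the independence number $\alpha$, the fractional independence number $\alpha^*$, the Lovász number $\vartheta$, Schrijver's variant $\vartheta^-$, or Szegedy's variant $\vartheta^+$. -/

import Mathlib

namespace SimpleGraph

/-- The strong product of two graphs. -/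
def strongProd {V W : Type*} (G : SimpleGraph V) (H : SimpleGraph W) : SimpleGraph (V × W) where
  Adj p q := (p.1 = q.1 ∧ H.Adj p.2 q.2) ∨ (G.Adj p.1 q.1 ∧ p.2 = q.2) ∨
    (G.Adj p.1 q.1 ∧ H.Adj p.2 q.2)
  symm := ⟨by
    rintro p q (⟨h, h'⟩ | ⟨h, h'⟩ | ⟨h, h'⟩)
    · exact Or.inl ⟨h.symm, h'.symm⟩
    · exact Or.inr (Or.inl ⟨h.symm, h'.symm⟩)
    · exact Or.inr (Or.inr ⟨h.symm, h'.symm⟩)⟩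
  loopless := ⟨by
    rintro p (⟨_, h⟩ | ⟨h, _⟩ | ⟨h, _⟩)
    · exact H.irrefl h
    · exact G.irrefl h
    · exact G.irrefl h⟩

/-- The ratios `α(G ⊠ W) / α(H ⊠ W)`, where `W` runs over all nonempty finite graphs
(up to isomorphism, these are the graphs on the vertex sets `Fin (n + 1)`). -/
def indepRatios {V U : Type*} (G : SimpleGraph V) (H : SimpleGraph U) : Set ℝ :=
  {r | ∃ (n : ℕ) (W : SimpleGraph (Fin (n + 1))),
    r = ((G.strongProd W).indepNum : ℝ) / ((H.strongProd W).indepNum : ℝ)}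

/-- The relative fractional independence number `α*(G|H)`, the supremum of
`α(G ⊠ W) / α(H ⊠ W)` over all graphs `W`. -/
noncomputable def relFracIndepNum {V U : Type*} (G : SimpleGraph V) (H : SimpleGraph U) : ℝ :=
  sSup (indepRatios G H)

/-- The feasible values of the linear program for the fractional independence number: total
weights `∑ v, w v`, where `w ≥ 0` has weight at most `1` on every clique. -/
def fracIndepValues {V : Type*} [Fintype V] (G : SimpleGraph V) : Set ℝ :=
  {r | ∃ w : V → ℝ, (∀ v, 0 ≤ w v) ∧
    (∀ s : Finset V, G.IsClique (s : Set V) → ∑ v ∈ s, w v ≤ 1) ∧ r = ∑ v, w v}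

/-- The fractional independence number `α*(G)`. -/
noncomputable def fracIndepNum {V : Type*} [Fintype V] (G : SimpleGraph V) : ℝ :=
  sSup (fracIndepValues G)

/-- The feasible values of the semidefinite program for the Lovász number. -/
def lovaszValues {V : Type*} [Fintype V] (G : SimpleGraph V) : Set ℝ :=
  {r | ∃ B : Matrix V V ℝ, B.PosSemidef ∧ B.trace = 1 ∧ (∀ i j, G.Adj i j → B i j = 0) ∧
    r = ∑ i, ∑ j, B i j}

/-- The Lovász number `ϑ(G)`. -/
noncomputable def lovaszTheta {V : Type*} [Fintype V] (G : SimpleGraph V) : ℝ :=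
  sSup (lovaszValues G)

/-- The feasible values of the semidefinite program for Schrijver's variant of the Lovász number:
the matrix is moreover entrywise nonnegative. -/
def schrijverValues {V : Type*} [Fintype V] (G : SimpleGraph V) : Set ℝ :=
  {r | ∃ B : Matrix V V ℝ, B.PosSemidef ∧ B.trace = 1 ∧ (∀ i j, G.Adj i j → B i j = 0) ∧
    (∀ i j, 0 ≤ B i j) ∧ r = ∑ i, ∑ j, B i j}

/-- Schrijver's variant `ϑ⁻(G)` of the Lovász number. -/
noncomputable def schrijverTheta {V : Type*} [Fintype V] (G : SimpleGraph V) : ℝ :=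
  sSup (schrijverValues G)

/-- The feasible values of the semidefinite program for Szegedy's variant of the Lovász number:
the entries on edges are only required to be nonpositive. -/
def szegedyValues {V : Type*} [Fintype V] (G : SimpleGraph V) : Set ℝ :=
  {r | ∃ B : Matrix V V ℝ, B.PosSemidef ∧ B.trace = 1 ∧ (∀ i j, G.Adj i j → B i j ≤ 0) ∧
    r = ∑ i, ∑ j, B i j}

/-- Szegedy's variant `ϑ⁺(G)` of the Lovász number. -/
noncomputable def szegedyTheta {V : Type*} [Fintype V] (G : SimpleGraph V) : ℝ :=
  sSup (szegedyValues G)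


theorem bddAbove_indepRatios {V U : Type*} [Fintype V] [Finite U] [Nonempty U]
    (G : SimpleGraph V) (H : SimpleGraph U) : BddAbove (indepRatios G H) := by
  classical
  refine ⟨Fintype.card V, ?_⟩
  rintro r ⟨n, W, rfl⟩
  obtain ⟨u⟩ := ‹Nonempty U›
  apply div_le_of_le_mul₀ (by positivity) (by positivity)
  obtain ⟨s, hs⟩ := (G.strongProd W).exists_isNIndepSet_indepNum
  have hc : s.card ≤ Fintype.card V * (H.strongProd W).indepNum := by
    have h1 := Finset.card_eq_sum_card_fiberwise (f := Prod.fst) (s := s) (t := Finset.univ)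
      (fun _ _ => Finset.mem_coe.2 (Finset.mem_univ _))
    rw [h1, ← smul_eq_mul, Fintype.card, ← Finset.sum_const]
    refine Finset.sum_le_sum fun v _ => ?_
    have hinj : Set.InjOn (fun p : V × Fin (n + 1) => (u, p.2))
        ({p ∈ s | p.1 = v} : Finset _) := by
      rintro ⟨a, b⟩ hp ⟨c, d⟩ hq h
      simp_all
    rw [← Finset.card_image_of_injOn hinj]
    apply IsIndepSet.card_le_indepNum
    intro x hx y hy hxy hadj
    simp only [Finset.coe_image, Finset.coe_filter, Set.mem_image, Set.mem_ofPred_eq] at hx hy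
    obtain ⟨⟨a, b⟩, ⟨ha, rfl⟩, rfl⟩ := hx
    obtain ⟨⟨c, d⟩, ⟨hc, h⟩, rfl⟩ := hy
    dsimp only at h
    subst h
    rcases hadj with ⟨_, h⟩ | ⟨h, _⟩ | ⟨h, _⟩
    · exact hs.1 ha hc (fun e => h.ne (by simpa using e)) (Or.inl ⟨rfl, h⟩)
    · exact H.irrefl h
    · exact H.irrefl h
  rw [hs.2] at hc
  exact_mod_cast hc

theorem bddAbove_fracIndepValues {V : Type*} [Fintype V] (G : SimpleGraph V) :
    BddAbove (fracIndepValues G) := by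
  refine ⟨Fintype.card V, ?_⟩
  rintro r ⟨w, _, h, rfl⟩
  calc ∑ v, w v ≤ ∑ _v : V, (1 : ℝ) :=
        Finset.sum_le_sum fun v _ => by simpa using h {v} (by simp)
    _ = Fintype.card V := by simp

theorem schrijverValues_subset_lovaszValues {V : Type*} [Fintype V] (G : SimpleGraph V) :
    schrijverValues G ⊆ lovaszValues G := by
  rintro r ⟨B, h1, h2, h3, _, h5⟩
  exact ⟨B, h1, h2, h3, h5⟩

theorem lovaszValues_subset_szegedyValues {V : Type*} [Fintype V] (G : SimpleGraph V) :
    lovaszValues G ⊆ szegedyValues G := by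
  rintro r ⟨B, h1, h2, h3, h5⟩
  exact ⟨B, h1, h2, fun i j h => (h3 i j h).le, h5⟩

theorem bddAbove_szegedyValues {V : Type*} [Fintype V] (G : SimpleGraph V) :
    BddAbove (szegedyValues G) := by
  classical
  refine ⟨Fintype.card V, ?_⟩
  rintro r ⟨B, hB, ht, _, rfl⟩
  have key : ∀ i j, B i j ≤ (B i i + B j j) / 2 := by
    intro i j
    have h := hB.dotProduct_mulVec_nonneg (Pi.single i 1 - Pi.single j 1)
    have hs : B j i = B i j := by simpa using congrFun (congrFun hB.1 i) j
    simp [Matrix.mulVec_sub, sub_dotProduct, dotProduct_sub, hs] at h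
    linarith
  have ht' : ∑ i, B i i = 1 := ht
  calc ∑ i, ∑ j, B i j ≤ ∑ i, ∑ j, (B i i + B j j) / 2 :=
        Finset.sum_le_sum fun i _ => Finset.sum_le_sum fun j _ => key i j
    _ = Fintype.card V := by
        simp only [← Finset.sum_div, Finset.sum_add_distrib, Finset.sum_const, ht',
          Finset.card_univ, nsmul_eq_mul, mul_one]
        rw [← Finset.mul_sum, ht']
        ring

theorem one_mem_schrijverValues {V : Type*} [Fintype V] [Nonempty V] (G : SimpleGraph V) :
    (1 : ℝ) ∈ schrijverValues G := by
  classical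
  obtain ⟨v⟩ := ‹Nonempty V›
  refine ⟨Matrix.diagonal (Pi.single v 1), ?_, ?_, ?_, ?_, ?_⟩
  · refine Matrix.PosSemidef.diagonal fun i => ?_
    by_cases h : i = v <;> simp [h]
  · simp [Matrix.trace]
  · intro i j h
    exact Matrix.diagonal_apply_ne _ h.ne
  · intro i j
    simp only [Matrix.diagonal_apply, Pi.single_apply]
    split_ifs <;> simp
  · simp [Matrix.diagonal_apply]

end SimpleGraph

/-! ### Independence numbers, strong products and the defining ratio -/

namespace SimpleGraph

/-! Each invariant satisfies `X(G) ≤ α*(G|H) X(H)`; exchanging `G` and `H` gives the second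
inequality. For `α`, a one-vertex `W` suffices.

For the others, `W` is a weighted complement of `G`: each vertex `g` of `Gᶜ` is blown up into about
`N * w g` copies. The diagonal is independent in `G ⊠ W`, while an independent set of `H ⊠ W` is
controlled by a map `φ` sending vertices of `G` to vertex sets of `H` as in `IsNonadjMap`. As `N`
grows this gives `∑ w g ≤ α*(G|H) * c` whenever `c` bounds `∑ w g * |φ g|` over all such `φ`
(`sum_le_relFracIndepNum_mul`).

It remains to choose `w` and transport along `φ`. Feasible weights `w` for `α*(G)` push forward to
feasible weights on `H` of total `∑ w g * |φ g|`. For the theta variants, `w` is the diagonal of an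
optimal matrix `B`, pushed forward as `A B Aᵀ`, where `A` is the incidence matrix of `φ`.
First-order optimality of `B` then yields `ϑ(G) * ∑ B g g * |φ g| ≤ ϑ(H)`. The three variants differ
only in the cones constraining the entries and are treated together. -/

theorem indepNum_le_of_injective {V W : Type*} [Finite W] {G : SimpleGraph V} {H : SimpleGraph W}
    [Finite V] (f : V → W) (hf : Function.Injective f) (h : ∀ a b, H.Adj (f a) (f b) → G.Adj a b) :
    G.indepNum ≤ H.indepNum := by
  classical
  cases nonempty_fintype W
  cases nonempty_fintype V
  obtain ⟨s, hs⟩ := G.exists_isNIndepSet_indepNum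
  rw [← hs.2, ← Finset.card_image_of_injective s hf]
  apply IsIndepSet.card_le_indepNum
  intro x hx y hy hxy hadj
  simp only [Finset.coe_image, Set.mem_image] at hx hy
  obtain ⟨a, ha, rfl⟩ := hx
  obtain ⟨b, hb, rfl⟩ := hy
  exact hs.1 ha hb (fun e => hxy (e ▸ rfl)) (h a b hadj)

theorem indepNum_congr {V W : Type*} [Finite V] [Finite W] {G : SimpleGraph V}
    {H : SimpleGraph W} (e : G ≃g H) : G.indepNum = H.indepNum :=
  le_antisymm (indepNum_le_of_injective e e.injective fun _ _ h => e.map_adj_iff.1 h)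
    (indepNum_le_of_injective e.symm e.symm.injective fun _ _ h => e.symm.map_adj_iff.1 h)

theorem indepNum_pos {V : Type*} [Finite V] [Nonempty V] (G : SimpleGraph V) :
    0 < G.indepNum := by
  cases nonempty_fintype V
  obtain ⟨v⟩ := ‹Nonempty V›
  have : ({v} : Finset V).card ≤ G.indepNum := IsIndepSet.card_le_indepNum (by simp)
  rwa [Finset.card_singleton] at this

/-- The strong product respects isomorphisms of the second factor. -/
def strongProdCongrRight {V W W' : Type*} (G : SimpleGraph V) {K : SimpleGraph W}
    {K' : SimpleGraph W'} (e : K ≃g K') : G.strongProd K ≃g G.strongProd K' where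
  toEquiv := (Equiv.refl V).prodCongr e.toEquiv
  map_rel_iff' := by
    rintro ⟨a, b⟩ ⟨c, d⟩
    have h : K'.Adj (e b) (e d) ↔ K.Adj b d := e.map_adj_iff
    simp [strongProd, h]

/-- The strong product with a one-vertex graph is the graph itself. -/
def strongProdUnique {V W : Type*} [Unique W] (G : SimpleGraph V) (K : SimpleGraph W) :
    G.strongProd K ≃g G where
  toEquiv := Equiv.prodUnique V W
  map_rel_iff' := by
    rintro ⟨a, b⟩ ⟨c, d⟩
    obtain rfl := Subsingleton.elim b d
    simp [strongProd]

theorem relFracIndepNum_nonneg {V U : Type*} (G : SimpleGraph V) (H : SimpleGraph U) :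
    0 ≤ G.relFracIndepNum H := by
  apply Real.sSup_nonneg
  rintro r ⟨n, W, rfl⟩
  positivity

section
variable {V U : Type*} [Fintype V] [Fintype U] [Nonempty U]
  (G : SimpleGraph V) (H : SimpleGraph U)

theorem indepNum_strongProd_le {W : Type*} [Finite W] [Nonempty W] (K : SimpleGraph W) :
    ((G.strongProd K).indepNum : ℝ) ≤ G.relFracIndepNum H * (H.strongProd K).indepNum := by
  cases nonempty_fintype W
  obtain ⟨n, hn⟩ : ∃ n, Fintype.card W = n + 1 :=
    Nat.exists_eq_succ_of_ne_zero Fintype.card_ne_zero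
  let e := K.overFinIso hn
  have h := le_csSup (bddAbove_indepRatios G H) ⟨n, K.overFin hn, rfl⟩
  rw [← indepNum_congr (strongProdCongrRight G e),
    ← indepNum_congr (strongProdCongrRight H e)] at h
  exact (div_le_iff₀ (by exact_mod_cast indepNum_pos _)).1 h

theorem indepNum_le_relFracIndepNum_mul :
    (G.indepNum : ℝ) ≤ G.relFracIndepNum H * H.indepNum := by
  have h := indepNum_strongProd_le G H (⊥ : SimpleGraph Unit)
  rwa [indepNum_congr (strongProdUnique G _), indepNum_congr (strongProdUnique H _)] at h

end

/-! ### Blowups of the complement as test graphs -/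

/-- A set-valued map from `G` to `H` whose values are independent sets, and which takes distinct
nonadjacent vertices to disjoint sets with no edges in between. -/
def IsNonadjMap {V U : Type*} (G : SimpleGraph V) (H : SimpleGraph U) (φ : V → Finset U) : Prop :=
  ∀ ⦃g₁ g₂ h₁ h₂⦄, h₁ ∈ φ g₁ → h₂ ∈ φ g₂ → (h₁ = h₂ ∨ H.Adj h₁ h₂) →
    (g₁ = g₂ ∧ h₁ = h₂) ∨ G.Adj g₁ g₂

/-- The complement of `G` with every vertex `g` replaced by `n g + 1` pairwise nonadjacent
copies. -/
def complBlowup {V : Type*} (G : SimpleGraph V) (n : V → ℕ) :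
    SimpleGraph (Σ g, Fin (n g + 1)) :=
  Gᶜ.comap Sigma.fst

/-- The pairs `(g, x)` with `x` a copy of `g` are independent: an edge of the blowup lies over
distinct nonadjacent vertices of `G`, contradicting the relation between first coordinates. -/
theorem sum_le_indepNum_strongProd_complBlowup {V : Type*} [Fintype V] (G : SimpleGraph V)
    (n : V → ℕ) : ∑ g, (n g + 1) ≤ (G.strongProd (G.complBlowup n)).indepNum := by
  classical
  have hinj : Function.Injective
      (fun x : Σ g, Fin (n g + 1) => ((x.1, x) : V × Σ g, Fin (n g + 1))) :=
    fun x y h => congrArg Prod.snd h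
  have hc : ∑ g, (n g + 1) = (Finset.univ.image
      (fun x : Σ g, Fin (n g + 1) => ((x.1, x) : V × Σ g, Fin (n g + 1)))).card := by
    rw [Finset.card_image_of_injective _ hinj]
    simp
  rw [hc]
  apply IsIndepSet.card_le_indepNum
  intro p hp q hq _ hadj
  simp only [Finset.coe_image, Set.mem_image] at hp hq
  obtain ⟨x, _, rfl⟩ := hp
  obtain ⟨y, _, rfl⟩ := hq
  rcases hadj with ⟨h, h'⟩ | ⟨h, h'⟩ | ⟨h, h'⟩
  · exact h'.1 h
  · dsimp only at h h'
    exact G.irrefl (h' ▸ h)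
  · exact h'.2 h

/-- Slice a maximum independent set by the vertices of the blowup and keep, for each `g`, the
largest slice over its copies. Slices over distinct nonadjacent `g`, `g'` lie over an edge of the
blowup, so no vertices of `H` in them are equal or adjacent. -/
theorem exists_isNonadjMap_indepNum_le {V U : Type*} [Fintype V] [Fintype U]
    (G : SimpleGraph V) (H : SimpleGraph U) (n : V → ℕ) : ∃ φ : V → Finset U,
    IsNonadjMap G H φ ∧
      (H.strongProd (G.complBlowup n)).indepNum ≤ ∑ g, (n g + 1) * (φ g).card := by
  classical
  obtain ⟨s, hs⟩ := (H.strongProd (G.complBlowup n)).exists_isNIndepSet_indepNum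
  let T : (Σ g, Fin (n g + 1)) → Finset U := fun x => {h | (h, x) ∈ s}
  have hmax (g : V) : ∃ j : Fin (n g + 1), ∀ i, (T ⟨g, i⟩).card ≤ (T ⟨g, j⟩).card :=
    Finite.exists_max fun j => (T ⟨g, j⟩).card
  choose j hj using hmax
  refine ⟨fun g => T ⟨g, j g⟩, ?_, ?_⟩
  · intro g g' h h' hh hh' hr
    simp only [T, Finset.mem_filter, Finset.mem_univ, true_and] at hh hh'
    by_contra! hcon
    by_cases hg : g = g'
    · subst hg
      have hne := hcon.1 rfl
      exact hs.1 hh hh' (fun e => hne (congrArg Prod.fst e))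
        (Or.inr (Or.inl ⟨hr.resolve_left hne, rfl⟩))
    · have hW : (G.complBlowup n).Adj ⟨g, j g⟩ ⟨g', j g'⟩ := ⟨hg, hcon.2⟩
      refine hs.1 hh hh' (fun e => hW.ne (congrArg Prod.snd e)) ?_
      rcases hr with hr | hr
      · exact Or.inl ⟨hr, hW⟩
      · exact Or.inr (Or.inr ⟨hr, hW⟩)
  · rw [← hs.2, Finset.card_eq_sum_card_fiberwise (f := Prod.snd) (t := Finset.univ)
      (fun _ _ => Finset.mem_coe.2 (Finset.mem_univ _)), Fintype.sum_sigma]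
    refine Finset.sum_le_sum fun g _ => ?_
    calc ∑ i, ({p ∈ s | p.2 = ⟨g, i⟩} : Finset _).card
        ≤ ∑ _i : Fin (n g + 1), (T ⟨g, j g⟩).card := by
          refine Finset.sum_le_sum fun i _ => le_trans ?_ (hj g i)
          refine Finset.card_le_card_of_injOn Prod.fst ?_ ?_
          · rintro ⟨a, b⟩ hp
            simp only [Finset.coe_filter, Set.mem_ofPred_eq] at hp
            obtain ⟨hp, rfl⟩ := hp
            simpa [T] using hp
          · rintro ⟨a, b⟩ hp ⟨c, d⟩ hq h
            simp_all
      _ = (n g + 1) * (T ⟨g, j g⟩).card := by simp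

/-- Approximates real weights by blowup sizes `⌊N * w g⌋ + 1`. The rounding error is at most `|V| *
|U|`, independent of `N`, and vanishes on dividing by `N`. -/
theorem sum_le_relFracIndepNum_mul {V U : Type*} [Fintype V] [Nonempty V] [Fintype U]
    [Nonempty U] {G : SimpleGraph V} {H : SimpleGraph U} {w : V → ℝ} (hw : ∀ g, 0 ≤ w g) {c : ℝ}
    (hc : ∀ φ : V → Finset U, IsNonadjMap G H φ → ∑ g, w g * (φ g).card ≤ c) :
    ∑ g, w g ≤ G.relFracIndepNum H * c := by
  have key (N : ℕ) : (N : ℝ) * ∑ g, w g ≤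
      G.relFracIndepNum H * (N * c + Fintype.card V * Fintype.card U) := by
    let n : V → ℕ := fun g => ⌊N * w g⌋₊
    have : Nonempty (Σ g, Fin (n g + 1)) := ⟨⟨Classical.arbitrary V, 0⟩⟩
    obtain ⟨φ, hφ, hle⟩ := exists_isNonadjMap_indepNum_le G H n
    calc (N : ℝ) * ∑ g, w g ≤ ∑ g, ((n g : ℝ) + 1) := by
          rw [Finset.mul_sum]
          exact Finset.sum_le_sum fun g _ => (Nat.lt_floor_add_one _).le
      _ ≤ (G.strongProd (G.complBlowup n)).indepNum := by
          exact_mod_cast sum_le_indepNum_strongProd_complBlowup G n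
      _ ≤ G.relFracIndepNum H * (H.strongProd (G.complBlowup n)).indepNum :=
          indepNum_strongProd_le G H _
      _ ≤ _ := by
          refine mul_le_mul_of_nonneg_left ?_ (relFracIndepNum_nonneg G H)
          calc ((H.strongProd (G.complBlowup n)).indepNum : ℝ)
              ≤ ∑ g, ((n g : ℝ) + 1) * (φ g).card := by exact_mod_cast hle
            _ ≤ ∑ g, (N * (w g * (φ g).card) + Fintype.card U) := by
                refine Finset.sum_le_sum fun g _ => ?_
                have h1 : (n g : ℝ) ≤ N * w g :=
                  Nat.floor_le (mul_nonneg N.cast_nonneg (hw g))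
                have h2 : ((φ g).card : ℝ) ≤ Fintype.card U := by
                  exact_mod_cast Finset.card_le_univ _
                have h3 := mul_le_mul_of_nonneg_right h1 (Nat.cast_nonneg (α := ℝ) (φ g).card)
                linarith
            _ = N * ∑ g, w g * (φ g).card + Fintype.card V * Fintype.card U := by
                simp [Finset.sum_add_distrib, Finset.mul_sum]
            _ ≤ _ := by
                have := mul_le_mul_of_nonneg_left (hc φ hφ) N.cast_nonneg
                linarith
  by_contra! hlt
  obtain ⟨N, hN⟩ := exists_nat_gt
    (G.relFracIndepNum H * (Fintype.card V * Fintype.card U) /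
      (∑ g, w g - G.relFracIndepNum H * c))
  rw [div_lt_iff₀ (by linarith)] at hN
  have := key N
  linarith

/-! ### The fractional independence number -/

section
variable {V U : Type*} [Fintype V] [Fintype U] {G : SimpleGraph V} {H : SimpleGraph U}

/-- Give `h` the weight `∑ w g` over all `g` with `h ∈ φ g`. A clique `K` of `H` meets each `φ g` at
most once, and the `g` whose `φ g` meets `K` form a clique of `G`, so `K` has weight at most `1`. -/
theorem IsNonadjMap.sum_mul_card_le_fracIndepNum {φ : V → Finset U} (hφ : IsNonadjMap G H φ)
    {w : V → ℝ} (hw : ∀ v, 0 ≤ w v)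
    (hcl : ∀ s : Finset V, G.IsClique (s : Set V) → ∑ v ∈ s, w v ≤ 1) :
    ∑ g, w g * (φ g).card ≤ H.fracIndepNum := by
  classical
  refine le_csSup (bddAbove_fracIndepValues H)
    ⟨fun h => ∑ g, if h ∈ φ g then w g else 0, fun h => Finset.sum_nonneg fun g _ => ?_,
      fun K hK => ?_, ?_⟩
  · split_ifs
    exacts [hw g, le_rfl]
  · rw [Finset.sum_comm]
    have hrel {h h'} (hh : h ∈ K) (hh' : h' ∈ K) : h = h' ∨ H.Adj h h' := by
      by_cases e : h = h'
      exacts [Or.inl e, Or.inr (hK hh hh' e)]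
    have hterm (g : V) : ∑ h ∈ K, (if h ∈ φ g then w g else 0) ≤
        if ∃ h ∈ K, h ∈ φ g then w g else 0 := by
      split_ifs with hex
      · obtain ⟨h, hh, hg⟩ := hex
        rw [Finset.sum_eq_single_of_mem h hh, if_pos hg]
        intro h' hh' hne
        refine if_neg fun hg' => ?_
        rcases hφ hg' hg (hrel hh' hh) with ⟨_, e⟩ | e
        exacts [hne e, G.irrefl e]
      · push Not at hex
        exact (Finset.sum_eq_zero fun h hh => if_neg (hex h hh)).le
    refine (Finset.sum_le_sum fun g _ => hterm g).trans ?_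
    rw [← Finset.sum_filter]
    refine hcl _ fun g hg g' hg' hne => ?_
    simp only [Finset.coe_filter, Finset.mem_univ, true_and, Set.mem_ofPred_eq] at hg hg'
    obtain ⟨h, hh, hg⟩ := hg
    obtain ⟨h', hh', hg'⟩ := hg'
    exact (hφ hg hg' (hrel hh hh')).resolve_left fun e => hne e.1
  · rw [Finset.sum_comm]
    refine Finset.sum_congr rfl fun g _ => ?_
    simp [mul_comm]

theorem fracIndepNum_le_relFracIndepNum_mul [Nonempty V] [Nonempty U] :
    G.fracIndepNum ≤ G.relFracIndepNum H * H.fracIndepNum := by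
  refine csSup_le ⟨0, 0, by simp, by simp, by simp⟩ ?_
  rintro r ⟨w, hw, hcl, rfl⟩
  exact sum_le_relFracIndepNum_mul hw fun φ hφ => hφ.sum_mul_card_le_fracIndepNum hw hcl

theorem fracIndepNum_pos [Nonempty V] : 0 < G.fracIndepNum := by
  classical
  obtain ⟨v⟩ := ‹Nonempty V›
  refine zero_lt_one.trans_le (le_csSup (bddAbove_fracIndepValues G)
    ⟨Pi.single v 1, fun u => ?_, fun s _ => ?_, by simp⟩)
  · by_cases h : u = v <;> simp [h]
  · simp only [Pi.single_apply, Finset.sum_ite_eq']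
    split_ifs <;> simp

end

end SimpleGraph

/-! ### The Lovász number and its variants, via cones of admissible entries -/

namespace SimpleGraph

/-- A common form of the feasible matrices, up to scaling, of the semidefinite programs for the
Lovász number and its variants: the entries on edges lie in the cone `C`, and all entries lie in
the cone `D`. -/
structure IsThetaFeasible {V : Type*} (C D : PointedCone ℝ ℝ) (G : SimpleGraph V)
    (B : Matrix V V ℝ) : Prop where
  posSemidef : B.PosSemidef
  adj_mem : ∀ i j, G.Adj i j → B i j ∈ C
  mem : ∀ i j, B i j ∈ D

/-- The feasible values of the semidefinite program given by the cones `C` and `D`. -/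
def thetaValues {V : Type*} [Fintype V] (C D : PointedCone ℝ ℝ) (G : SimpleGraph V) : Set ℝ :=
  {r | ∃ B : Matrix V V ℝ, IsThetaFeasible C D G B ∧ B.trace = 1 ∧ r = ∑ i, ∑ j, B i j}

end SimpleGraph

theorem Matrix.PosSemidef.sum_sum_mul_nonneg {V : Type*} [Fintype V] {B : Matrix V V ℝ}
    (hB : B.PosSemidef) (x : V → ℝ) : 0 ≤ ∑ i, ∑ j, x i * B i j * x j := by
  have h := hB.dotProduct_mulVec_nonneg x
  simpa [dotProduct, Matrix.mulVec, Finset.mul_sum, mul_assoc] using h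

theorem Matrix.isClosed_setOf_posSemidef {V : Type*} [Fintype V] :
    IsClosed {B : Matrix V V ℝ | B.PosSemidef} := by
  simp only [Matrix.posSemidef_iff_dotProduct_mulVec, Set.ofPred_and, Set.ofPred_forall]
  refine IsClosed.inter ?_ (isClosed_iInter fun x => ?_)
  · exact isClosed_eq (by fun_prop) continuous_id
  · exact isClosed_le continuous_const (by fun_prop)

/-- Testing on `e i ± e j` bounds the entry by the mean of two diagonal entries. This makes the
feasible set bounded, hence compact. -/
theorem Matrix.PosSemidef.abs_apply_le_trace {V : Type*} [Fintype V] {B : Matrix V V ℝ}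
    (hB : B.PosSemidef) (i j : V) : |B i j| ≤ B.trace := by
  classical
  have hd (k : V) : B k k ≤ B.trace :=
    Finset.single_le_sum (f := fun k => B k k) (fun k _ => hB.diag_nonneg) (Finset.mem_univ k)
  have hs : B j i = B i j := by simpa using congrFun (congrFun hB.1 i) j
  have h1 := hB.dotProduct_mulVec_nonneg (Pi.single i 1 - Pi.single j 1)
  have h2 := hB.dotProduct_mulVec_nonneg (Pi.single i 1 + Pi.single j 1)
  simp [Matrix.mulVec_sub, sub_dotProduct, dotProduct_sub, hs] at h1
  simp [Matrix.mulVec_add, add_dotProduct, dotProduct_add, hs] at h2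
  have := hd i
  have := hd j
  rw [abs_le]
  constructor <;> linarith

namespace SimpleGraph

section
variable {V U : Type*} [Fintype V] [Fintype U] {G : SimpleGraph V} {H : SimpleGraph U}
  {C D : PointedCone ℝ ℝ}

theorem bddAbove_thetaValues (hC : ∀ x ∈ C, x ≤ 0) : BddAbove (thetaValues C D G) := by
  refine (bddAbove_szegedyValues G).mono ?_
  rintro r ⟨B, hB, ht, rfl⟩
  exact ⟨B, hB.posSemidef, ht, fun i j h => hC _ (hB.adj_mem i j h), rfl⟩

theorem one_mem_thetaValues [Nonempty V] (hD : ∀ x, 0 ≤ x → x ∈ D) :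
    (1 : ℝ) ∈ thetaValues C D G := by
  obtain ⟨B, h1, h2, h3, h4, h5⟩ := one_mem_schrijverValues G
  exact ⟨B, ⟨h1, fun i j h => by simp [h3 i j h], fun i j => hD _ (h4 i j)⟩, h2, h5⟩

theorem one_le_sSup_thetaValues [Nonempty V] (hC : ∀ x ∈ C, x ≤ 0) (hD : ∀ x, 0 ≤ x → x ∈ D) :
    1 ≤ sSup (thetaValues C D G) :=
  le_csSup (bddAbove_thetaValues hC) (one_mem_thetaValues hD)

/-- The maximum in the semidefinite program is attained. -/
theorem exists_isThetaFeasible_eq_sSup [Nonempty V]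
    (hD : ∀ x, 0 ≤ x → x ∈ D) (hC' : IsClosed (C : Set ℝ)) (hD' : IsClosed (D : Set ℝ)) :
    ∃ B : Matrix V V ℝ, IsThetaFeasible C D G B ∧ B.trace = 1 ∧
      ∑ i, ∑ j, B i j = sSup (thetaValues C D G) := by
  let S : Set (Matrix V V ℝ) := {B | IsThetaFeasible C D G B ∧ B.trace = 1}
  have hS : S = {B | B.PosSemidef} ∩ ({B | ∀ i j, G.Adj i j → B i j ∈ C} ∩
      ({B | ∀ i j, B i j ∈ D} ∩ {B | B.trace = 1})) := by
    ext B
    exact ⟨fun h => ⟨h.1.1, h.1.2, h.1.3, h.2⟩, fun h => ⟨⟨h.1, h.2.1, h.2.2.1⟩, h.2.2.2⟩⟩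
  have happ (i j : V) : Continuous fun B : Matrix V V ℝ => B i j := by fun_prop
  have hcl : IsClosed S := by
    rw [hS]
    refine Matrix.isClosed_setOf_posSemidef.inter (IsClosed.inter ?_ (IsClosed.inter ?_ ?_))
    · simp only [Set.ofPred_forall]
      exact isClosed_iInter fun i => isClosed_iInter fun j => isClosed_iInter fun _ =>
        hC'.preimage (happ i j)
    · simp only [Set.ofPred_forall]
      exact isClosed_iInter fun i => isClosed_iInter fun j => hD'.preimage (happ i j)
    · exact isClosed_eq (by fun_prop) continuous_const
  have hK : IsCompact (Set.univ.pi fun _ : V => Set.univ.pi fun _ : V => Set.Icc (-1 : ℝ) 1) :=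
    isCompact_univ_pi fun _ => isCompact_univ_pi fun _ => isCompact_Icc
  have hSc : IsCompact S := by
    refine hK.of_isClosed_subset hcl fun B hB i _ j _ => ?_
    have := hB.1.posSemidef.abs_apply_le_trace i j
    rw [hB.2] at this
    exact abs_le.1 this
  have himg : thetaValues C D G = (fun B : Matrix V V ℝ => ∑ i, ∑ j, B i j) '' S := by
    ext r
    constructor
    · rintro ⟨B, h, ht, rfl⟩
      exact ⟨B, ⟨h, ht⟩, rfl⟩
    · rintro ⟨B, h, rfl⟩
      exact ⟨B, h.1, h.2, rfl⟩
  have hmem : sSup (thetaValues C D G) ∈ thetaValues C D G := by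
    have hcomp : IsCompact (thetaValues C D G) := himg ▸ hSc.image (by fun_prop)
    exact hcomp.sSup_mem ⟨1, one_mem_thetaValues hD⟩
  obtain ⟨B, hB, ht, h⟩ := hmem
  exact ⟨B, hB, ht, h.symm⟩

theorem IsThetaFeasible.sum_le (hC : ∀ x ∈ C, x ≤ 0) {B : Matrix V V ℝ}
    (hB : IsThetaFeasible C D G B) :
    ∑ i, ∑ j, B i j ≤ sSup (thetaValues C D G) * B.trace := by
  rcases hB.posSemidef.trace_nonneg.eq_or_lt with h0 | hpos
  · rw [hB.posSemidef.trace_eq_zero_iff.1 h0.symm]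
    simp
  · rw [← div_le_iff₀ hpos]
    refine le_csSup (bddAbove_thetaValues hC) ⟨B.trace⁻¹ • B, ⟨?_, fun i j h => ?_, fun i j => ?_⟩,
      ?_, ?_⟩
    · exact hB.posSemidef.smul (inv_nonneg.2 hpos.le)
    · exact C.smul_mem (inv_nonneg.2 hpos.le) (hB.adj_mem i j h)
    · exact D.smul_mem (inv_nonneg.2 hpos.le) (hB.mem i j)
    · rw [Matrix.trace_smul, smul_eq_mul, inv_mul_cancel₀ hpos.ne']
    · simp [← Finset.mul_sum, div_eq_inv_mul]

theorem _root_.Matrix.mul_mul_transpose_apply {R m n : Type*} [CommSemiring R] [Fintype n]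
    (A : Matrix m n R) (B : Matrix n n R) (i j : m) :
    (A * B * A.transpose) i j = ∑ k, ∑ l, A i k * B k l * A j l := by
  simp only [Matrix.mul_apply, Matrix.transpose_apply, Finset.sum_mul]
  exact Finset.sum_comm

/-- Each new entry is a nonnegative combination of entries of `B`, and at an edge of `H` only
entries at edges of `G` contribute; cones are closed under such combinations. -/
theorem IsThetaFeasible.conj {B : Matrix V V ℝ} (hB : IsThetaFeasible C D G B)
    {A : Matrix U V ℝ} (hA : ∀ h g, 0 ≤ A h g)
    (hadj : ∀ h h' g g', H.Adj h h' → A h g ≠ 0 → A h' g' ≠ 0 → G.Adj g g') :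
    IsThetaFeasible C D H (A * B * A.transpose) where
  posSemidef := by
    simpa using hB.posSemidef.mul_mul_conjTranspose_same A
  adj_mem h h' hh := by
    rw [Matrix.mul_mul_transpose_apply]
    refine C.sum_mem fun g _ => C.sum_mem fun g' _ => ?_
    by_cases h1 : A h g = 0
    · simp [h1]
    by_cases h2 : A h' g' = 0
    · simp [h2]
    rw [mul_right_comm]
    exact C.smul_mem (mul_nonneg (hA _ _) (hA _ _)) (hB.adj_mem _ _ (hadj h h' g g' hh h1 h2))
  mem h h' := by
    rw [Matrix.mul_mul_transpose_apply]
    refine D.sum_mem fun g _ => D.sum_mem fun g' _ => ?_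
    rw [mul_right_comm]
    exact D.smul_mem (mul_nonneg (hA _ _) (hA _ _)) (hB.mem _ _)

/-- First-order optimality: the row sums of an optimal matrix are proportional to its diagonal. -/
theorem IsThetaFeasible.sum_row_eq (hC : ∀ x ∈ C, x ≤ 0) {B : Matrix V V ℝ}
    (hB : IsThetaFeasible C D G B) (ht : B.trace = 1)
    (hopt : ∑ i, ∑ j, B i j = sSup (thetaValues C D G)) (g : V) :
    ∑ j, B g j = sSup (thetaValues C D G) * B g g := by
  classical
  set θ := sSup (thetaValues C D G)
  set R := ∑ j, B g j
  have hs (i j : V) : B j i = B i j := by simpa using congrFun (congrFun hB.posSemidef.1 i) j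
  -- Scale row and column `g` by `1 + t`; `t ≥ -1` keeps the factors nonnegative, as the cones
  -- require. Comparing the new sum with `θ` times the new trace gives the inequality.
  have key (t : ℝ) (h : -1 ≤ t) : 0 ≤ t * (2 * (θ * B g g - R)) + t ^ 2 * (θ * B g g - B g g) := by
    let d : V → ℝ := fun i => 1 + if i = g then t else 0
    have hd (i : V) : 0 ≤ d i := by
      simp only [d]
      split_ifs <;> linarith
    have hf : IsThetaFeasible C D G (Matrix.diagonal d * B * (Matrix.diagonal d).transpose) := by
      refine hB.conj (fun i j => ?_) fun i i' j j' hij h1 h2 => ?_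
      · rw [Matrix.diagonal_apply]
        split_ifs
        exacts [hd _, le_rfl]
      · obtain rfl : i = j := by
          by_contra hne
          exact h1 (Matrix.diagonal_apply_ne _ hne)
        obtain rfl : i' = j' := by
          by_contra hne
          exact h2 (Matrix.diagonal_apply_ne _ hne)
        exact hij
    have hle := hf.sum_le hC
    have hsum : ∑ i, ∑ j, d i * B i j * d j = θ + 2 * t * R + t ^ 2 * B g g := by
      have hcol : ∑ i, B i g = R := Finset.sum_congr rfl fun i _ => hs g i
      simp only [d, add_mul, mul_add, one_mul, mul_one, Finset.sum_add_distrib, ite_mul, zero_mul,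
        mul_ite, mul_zero, Finset.sum_ite_eq', Finset.mem_univ, if_true, hopt]
      simp only [← Finset.sum_mul, hcol, Finset.sum_ite_irrel, Finset.sum_const_zero,
        Finset.sum_ite_eq', Finset.mem_univ, if_true, ← Finset.mul_sum]
      ring
    have htr : ∑ i, d i * B i i * d i = 1 + 2 * t * B g g + t ^ 2 * B g g := by
      have ht' : ∑ i, B i i = 1 := ht
      simp only [d, add_mul, mul_add, one_mul, mul_one, Finset.sum_add_distrib, ite_mul, zero_mul,
        mul_ite, mul_zero, Finset.sum_ite_eq', Finset.mem_univ, if_true, ht']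
      ring
    simp only [Matrix.diagonal_transpose, Matrix.trace, Matrix.diag_apply, Matrix.mul_diagonal,
      Matrix.diagonal_mul, hsum, htr] at hle
    linarith
  by_contra hne
  set a := 2 * (θ * B g g - R) with ha
  set b := θ * B g g - B g g
  have ha0 : a ≠ 0 := fun h => hne (by linarith)
  have hq : 0 < |a| + |b| := by positivity
  -- A `t` of sign opposite to `a`, at least `-1/2`, and small enough that the linear term outweighs
  -- the quadratic one.
  have h1 := key (-a / (2 * (|a| + |b|))) (by
    rw [le_div_iff₀ (by positivity)]
    nlinarith [le_abs_self a, abs_nonneg a, abs_nonneg b])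
  have h2 : (-a / (2 * (|a| + |b|))) * a + (-a / (2 * (|a| + |b|))) ^ 2 * b =
      a ^ 2 / (4 * (|a| + |b|) ^ 2) * (b - 2 * (|a| + |b|)) := by
    field_simp
    ring
  rw [h2] at h1
  have h3 : b - 2 * (|a| + |b|) < 0 := by
    have := le_abs_self b
    have := abs_nonneg b
    have : 0 < |a| := abs_pos.2 ha0
    linarith
  have h4 : 0 < a ^ 2 / (4 * (|a| + |b|) ^ 2) := by positivity
  exact absurd h1 (mul_neg_of_pos_of_neg h4 h3).not_ge

/-- With `m g = |φ g|` and `M = ∑ B g g * m g`, the matrix `A B Aᵀ` is feasible for `H` up to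
scaling, has trace at most `M` and entry sum `mᵀ B m ≥ θ M²`. -/
theorem IsNonadjMap.sSup_thetaValues_mul_le (hC : ∀ x ∈ C, x ≤ 0) {B : Matrix V V ℝ}
    (hB : IsThetaFeasible C D G B) (ht : B.trace = 1)
    (hopt : ∑ i, ∑ j, B i j = sSup (thetaValues C D G)) (hθ : 0 ≤ sSup (thetaValues C D H))
    {φ : V → Finset U} (hφ : IsNonadjMap G H φ) :
    sSup (thetaValues C D G) * ∑ g, B g g * (φ g).card ≤ sSup (thetaValues C D H) := by
  classical
  set θ := sSup (thetaValues C D G)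
  set m : V → ℝ := fun g => (φ g).card with hm
  set M := ∑ g, B g g * m g with hM
  have hM0 : 0 ≤ M :=
    Finset.sum_nonneg fun g _ => mul_nonneg hB.posSemidef.diag_nonneg (Nat.cast_nonneg _)
  have hs (i j : V) : B j i = B i j := by simpa using congrFun (congrFun hB.posSemidef.1 i) j
  have hrow := hB.sum_row_eq hC ht hopt
  let A : Matrix U V ℝ := fun h g => if h ∈ φ g then 1 else 0
  have hA (h g) : A h g ≠ 0 → h ∈ φ g := fun e => by
    by_contra hn
    exact e (if_neg hn)
  have hf : IsThetaFeasible C D H (A * B * A.transpose) := by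
    refine hB.conj (fun h g => ?_) fun h h' g g' hh h1 h2 => ?_
    · simp only [A]
      split_ifs <;> simp
    · exact (hφ (hA _ _ h1) (hA _ _ h2) (Or.inr hh)).resolve_left fun e => hh.ne e.2
  have hAm (g : V) : ∑ h, A h g = m g := by simp [A, hm]
  have hsum : ∑ h, ∑ h', (A * B * A.transpose) h h' = ∑ g, ∑ g', m g * B g g' * m g' := by
    simp only [Matrix.mul_mul_transpose_apply]
    calc ∑ h, ∑ h', ∑ g, ∑ g', A h g * B g g' * A h' g'
        = ∑ h, ∑ g, ∑ g', A h g * B g g' * m g' := by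
          refine Finset.sum_congr rfl fun h _ => ?_
          rw [Finset.sum_comm]
          refine Finset.sum_congr rfl fun g _ => ?_
          rw [Finset.sum_comm]
          exact Finset.sum_congr rfl fun g' _ => by rw [← Finset.mul_sum, hAm]
      _ = _ := by
          rw [Finset.sum_comm]
          refine Finset.sum_congr rfl fun g _ => ?_
          rw [Finset.sum_comm]
          exact Finset.sum_congr rfl fun g' _ => by rw [← Finset.sum_mul, ← Finset.sum_mul, hAm]
  -- Off-diagonal entries of `B` enter the trace only when `φ g` and `φ g'` share a vertex; then `g`
  -- and `g'` are adjacent and the entry is nonpositive.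
  have htr : (A * B * A.transpose).trace ≤ M := by
    have hdiag : M = ∑ h, ∑ g, A h g * B g g := by
      rw [Finset.sum_comm]
      exact Finset.sum_congr rfl fun g _ => by rw [← Finset.sum_mul, hAm, mul_comm]
    simp only [hdiag, Matrix.trace, Matrix.diag_apply, Matrix.mul_mul_transpose_apply]
    refine Finset.sum_le_sum fun h _ => Finset.sum_le_sum fun g _ => ?_
    by_cases hg : h ∈ φ g
    · have : ∑ g', A h g * B g g' * A h g' ≤ ∑ g', if g' = g then A h g * B g g' else 0 := by
        refine Finset.sum_le_sum fun g' _ => ?_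
        by_cases hg' : h ∈ φ g'
        · rcases hφ hg hg' (Or.inl rfl) with ⟨rfl, _⟩ | e
          · simp [A, hg]
          · simpa [A, hg, hg', e.ne'] using hC _ (hB.adj_mem _ _ e)
        · have : g' ≠ g := fun e => hg' (e ▸ hg)
          simp [A, hg', this]
      simpa using this
    · simp [A, hg]
  -- Positivity of `B` at `m - M * 1`. As row sums are `θ * B g g`, each cross term is `θ * M`, and
  -- the total sum is `θ`.
  have hquad : θ * M ^ 2 ≤ ∑ g, ∑ g', m g * B g g' * m g' := by
    have h0 := hB.posSemidef.sum_sum_mul_nonneg fun g => m g - M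
    have e1 : ∑ g, ∑ g', m g * B g g' = θ * M := by
      simp only [← Finset.mul_sum, hrow]
      rw [hM, Finset.mul_sum]
      exact Finset.sum_congr rfl fun g _ => by ring
    have e2 : ∑ g, ∑ g', B g g' * m g' = θ * M := by
      rw [Finset.sum_comm, ← e1]
      exact Finset.sum_congr rfl fun g _ => Finset.sum_congr rfl fun g' _ => by
        rw [hs, mul_comm]
    have e3 : ∑ g, ∑ g', (m g - M) * B g g' * (m g' - M) = ∑ g, ∑ g', m g * B g g' * m g'
        - M * ∑ g, ∑ g', m g * B g g' - M * ∑ g, ∑ g', B g g' * m g'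
        + M ^ 2 * ∑ g, ∑ g', B g g' := by
      simp only [Finset.mul_sum, ← Finset.sum_sub_distrib, ← Finset.sum_add_distrib]
      exact Finset.sum_congr rfl fun g _ => Finset.sum_congr rfl fun g' _ => by ring
    rw [e3, e1, e2, hopt] at h0
    linarith
  have hfin : θ * M ^ 2 ≤ sSup (thetaValues C D H) * M :=
    hquad.trans (hsum ▸ (hf.sum_le hC).trans (mul_le_mul_of_nonneg_left htr hθ))
  rcases hM0.eq_or_lt with h | h
  · rw [← h, mul_zero]
    exact hθ
  · exact le_of_mul_le_mul_right (by linarith) h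

/-- The weights are the diagonal of an optimal matrix, of total `1`, so the bound `c` is the
quotient of the two optima. -/
theorem sSup_thetaValues_le_relFracIndepNum_mul [Nonempty V] [Nonempty U]
    (hC : ∀ x ∈ C, x ≤ 0) (hD : ∀ x, 0 ≤ x → x ∈ D) (hC' : IsClosed (C : Set ℝ))
    (hD' : IsClosed (D : Set ℝ)) :
    sSup (thetaValues C D G) ≤ G.relFracIndepNum H * sSup (thetaValues C D H) := by
  obtain ⟨B, hB, ht, hopt⟩ := exists_isThetaFeasible_eq_sSup (G := G) hD hC' hD'
  have hG : 0 < sSup (thetaValues C D G) :=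
    zero_lt_one.trans_le (one_le_sSup_thetaValues hC hD)
  have hH : 0 ≤ sSup (thetaValues C D H) :=
    zero_le_one.trans (one_le_sSup_thetaValues hC hD)
  have h := sum_le_relFracIndepNum_mul (G := G) (H := H) (w := fun g => B g g)
    (c := sSup (thetaValues C D H) / sSup (thetaValues C D G))
    (fun g => hB.posSemidef.diag_nonneg) fun φ hφ => by
      rw [le_div_iff₀' hG]
      exact hφ.sSup_thetaValues_mul_le hC hB ht hopt hH
  have ht' : ∑ g, B g g = 1 := ht
  rwa [ht', ← mul_div_assoc, le_div_iff₀ hG, one_mul] at h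

/-! ### Specialization of the cones to the three theta invariants -/

theorem thetaValues_bot_top : thetaValues ⊥ ⊤ G = lovaszValues G := by
  ext r
  constructor
  · rintro ⟨B, hB, ht, hr⟩
    exact ⟨B, hB.posSemidef, ht, by simpa using hB.adj_mem, hr⟩
  · rintro ⟨B, h1, h2, h3, hr⟩
    exact ⟨B, ⟨h1, by simpa using h3, by simp⟩, h2, hr⟩

theorem thetaValues_bot_positive :
    thetaValues ⊥ (PointedCone.positive ℝ ℝ) G = schrijverValues G := by
  ext r
  constructor
  · rintro ⟨B, hB, ht, hr⟩
    exact ⟨B, hB.posSemidef, ht, by simpa using hB.adj_mem, by simpa using hB.mem, hr⟩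
  · rintro ⟨B, h1, h2, h3, h4, hr⟩
    exact ⟨B, ⟨h1, by simpa using h3, by simpa using h4⟩, h2, hr⟩

open scoped Pointwise in
theorem thetaValues_neg_positive_top :
    thetaValues (-PointedCone.positive ℝ ℝ) ⊤ G = szegedyValues G := by
  ext r
  constructor
  · rintro ⟨B, hB, ht, hr⟩
    exact ⟨B, hB.posSemidef, ht, by simpa using hB.adj_mem, hr⟩
  · rintro ⟨B, h1, h2, h3, hr⟩
    exact ⟨B, ⟨h1, by simpa using h3, by simp⟩, h2, hr⟩

theorem isClosed_positive : IsClosed (PointedCone.positive ℝ ℝ : Set ℝ) :=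
  isClosed_Ici (a := (0 : ℝ))

theorem lovaszTheta_le_relFracIndepNum_mul [Nonempty V] [Nonempty U] :
    G.lovaszTheta ≤ G.relFracIndepNum H * H.lovaszTheta := by
  simp only [lovaszTheta, ← thetaValues_bot_top]
  exact sSup_thetaValues_le_relFracIndepNum_mul (by simp) (by simp) (by simp) (by simp)

theorem schrijverTheta_le_relFracIndepNum_mul [Nonempty V] [Nonempty U] :
    G.schrijverTheta ≤ G.relFracIndepNum H * H.schrijverTheta := by
  simp only [schrijverTheta, ← thetaValues_bot_positive]
  exact sSup_thetaValues_le_relFracIndepNum_mul (by simp) (by simp) (by simp) isClosed_positive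

theorem szegedyTheta_le_relFracIndepNum_mul [Nonempty V] [Nonempty U] :
    G.szegedyTheta ≤ G.relFracIndepNum H * H.szegedyTheta := by
  simp only [szegedyTheta, ← thetaValues_neg_positive_top]
  exact sSup_thetaValues_le_relFracIndepNum_mul (by simp) (by simp)
    (isClosed_positive.preimage continuous_neg) (by simp)

theorem schrijverTheta_pos [Nonempty V] : 0 < G.schrijverTheta :=
  zero_lt_one.trans_le (le_csSup ((bddAbove_szegedyValues G).mono
    ((schrijverValues_subset_lovaszValues G).trans (lovaszValues_subset_szegedyValues G)))
    (one_mem_schrijverValues G))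

theorem lovaszTheta_pos [Nonempty V] : 0 < G.lovaszTheta :=
  zero_lt_one.trans_le (le_csSup
    ((bddAbove_szegedyValues G).mono (lovaszValues_subset_szegedyValues G))
    (schrijverValues_subset_lovaszValues G (one_mem_schrijverValues G)))

theorem szegedyTheta_pos [Nonempty V] : 0 < G.szegedyTheta :=
  zero_lt_one.trans_le (le_csSup (bddAbove_szegedyValues G)
    (lovaszValues_subset_szegedyValues G
      (schrijverValues_subset_lovaszValues G (one_mem_schrijverValues G))))

end

end SimpleGraph

/-! ### Assembly of the two-sided bounds -/

theorem ge_div_and_div_ge_one_div {x y a b : ℝ} (hx : 0 < x) (hy : 0 < y) (ha : x ≤ a * y)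
    (hb : y ≤ b * x) : a ≥ x / y ∧ x / y ≥ 1 / b := by
  have hb0 : 0 < b := pos_of_mul_pos_left (hy.trans_le hb) hx.le
  refine ⟨(div_le_iff₀ hy).2 ha, ?_⟩
  rw [ge_iff_le, div_le_div_iff₀ hb0 hy]
  linarith

theorem theorem3 {V U : Type*} [Fintype V] [Nonempty V] [Fintype U] [Nonempty U]
    (G : SimpleGraph V) (H : SimpleGraph U) :
    (G.relFracIndepNum H ≥ (G.indepNum : ℝ) / (H.indepNum : ℝ) ∧
      (G.indepNum : ℝ) / (H.indepNum : ℝ) ≥ 1 / H.relFracIndepNum G) ∧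
    (G.relFracIndepNum H ≥ G.fracIndepNum / H.fracIndepNum ∧
      G.fracIndepNum / H.fracIndepNum ≥ 1 / H.relFracIndepNum G) ∧
    (G.relFracIndepNum H ≥ G.lovaszTheta / H.lovaszTheta ∧
      G.lovaszTheta / H.lovaszTheta ≥ 1 / H.relFracIndepNum G) ∧
    (G.relFracIndepNum H ≥ G.schrijverTheta / H.schrijverTheta ∧
      G.schrijverTheta / H.schrijverTheta ≥ 1 / H.relFracIndepNum G) ∧
    (G.relFracIndepNum H ≥ G.szegedyTheta / H.szegedyTheta ∧
      G.szegedyTheta / H.szegedyTheta ≥ 1 / H.relFracIndepNum G) := by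
  open SimpleGraph in
  exact ⟨ge_div_and_div_ge_one_div (by exact_mod_cast G.indepNum_pos)
      (by exact_mod_cast H.indepNum_pos) (indepNum_le_relFracIndepNum_mul G H)
      (indepNum_le_relFracIndepNum_mul H G),
    ge_div_and_div_ge_one_div fracIndepNum_pos fracIndepNum_pos
      fracIndepNum_le_relFracIndepNum_mul fracIndepNum_le_relFracIndepNum_mul,
    ge_div_and_div_ge_one_div lovaszTheta_pos lovaszTheta_pos
      lovaszTheta_le_relFracIndepNum_mul lovaszTheta_le_relFracIndepNum_mul,
    ge_div_and_div_ge_one_div schrijverTheta_pos schrijverTheta_pos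
      schrijverTheta_le_relFracIndepNum_mul schrijverTheta_le_relFracIndepNum_mul,
    ge_div_and_div_ge_one_div szegedyTheta_pos szegedyTheta_pos
      szegedyTheta_le_relFracIndepNum_mul szegedyTheta_le_relFracIndepNum_mul⟩
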